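/- Let $\Gamma$ be a countable discrete group acting by homeomorphisms on a compact Hausdorff space $X$. Let $\mu$ be a Borel measure on $X$ that is quasi-invariant (elements of $\Gamma$ map $\mu$-null sets to $\mu$-null sets) and such that for every $s\in\Gamma$ the translate $s_*\mu$ has a Radon–Nikodym derivative $\rho_s=\frac{d(s_*\mu)}{d\mu}$, so that $\int_X f\,d\mu=\int_X f(s^{-1}x)\,\rho_s(x)\,d\mu(x)$ for all measurable $f\ge 0$ (this existence is automatic if $\mu$ is $\sigma$-finite). Let $U$ be the unitary representation of $\Gamma$ on $L^2(X,\mu)$ given by $(U_sf)(x)=f(s^{-1}x)\,\rho_s(x)^{1/2}$, and suppose that $U$ weakly contains the trivial representation, that is, $\bigl|\sum_s a_s\bigr|\le\bigl\|\sum_s a_sU_s\bigr\|$ for every $\sum_s a_s s\in\mathbb C[\Gamma]$. Then: 1. the action of $\Gamma$ on $X$ is amenable if and only if $\Gamma$ is amenable; 2. the action of $\Gamma$ on $X$ is a-T-menable if and only if $\Gamma$ is a-T-menable. In particular, such an action of a non-a-T-menable group is never a-T-menable. Here $h\colon\Gamma\to\mathbb C$ is positive definite if $[h(s_is_j^{-1})]_{i,j}$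 is positive semidefinite for all $s_1,\dots,s_n\in\Gamma$, and $h\colon X\times\Gamma\to\mathbb C$ is positive definite if $[h(s_i.x,\,s_is_j^{-1})]_{i,j}$ is positive semidefinite for all $s_1,\dots,s_n\in\Gamma$ and $x\in X$. The group $\Gamma$ is amenable (respectively a-T-menable) if there is a sequence of finitely supported positive definite functions (respectively positive definite functions vanishing at infinity) on $\Gamma$ converging pointwise to $1$. The action is amenable (respectively a-T-menable) if there is a sequence of positive definite functions in $C_c(X\times\Gamma)$ (respectively $C_0(X\times\Gamma)$) converging to $1$ uniformly on compact sets. -/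

import Mathlib

open MeasureTheory Filter Topology
open scoped ENNReal ComplexOrder CompactlySupported ZeroAtInfty

set_option linter.unusedSectionVars false

noncomputable section

namespace GroupDynamics

/-! ### Unitary representations and weak containment -/

section Representations

variable {Γ : Type*} [Group Γ]

/-- The `*`-homomorphism of the complex group ring determined by a unitary representation
`π`, that is, `∑ a_s s ↦ ∑ a_s π_s` (as an algebra homomorphism). -/
def groupRingHom {H : Type*} [NormedAddCommGroup H] [InnerProductSpace ℂ H] [CompleteSpace H]
    (π : Γ →* unitary (H →L[ℂ] H)) : MonoidAlgebra ℂ Γ →ₐ[ℂ] (H →L[ℂ] H) :=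
  MonoidAlgebra.lift ℂ (H →L[ℂ] H) Γ ((unitary (H →L[ℂ] H)).subtype.comp π)

/-- The unitary representation `π` weakly contains the unitary representation `σ`:
`‖σ(a)‖ ≤ ‖π(a)‖` for every `a` in the complex group ring. -/
def WeaklyContains {H : Type*} [NormedAddCommGroup H] [InnerProductSpace ℂ H] [CompleteSpace H]
    {K : Type*} [NormedAddCommGroup K] [InnerProductSpace ℂ K] [CompleteSpace K]
    (π : Γ →* unitary (H →L[ℂ] H)) (σ : Γ →* unitary (K →L[ℂ] K)) : Prop :=
  ∀ a : MonoidAlgebra ℂ Γ, ‖groupRingHom σ a‖ ≤ ‖groupRingHom π a‖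

/-- The trivial representation of `Γ` on `ℂ`. -/
def trivialRep (Γ : Type*) [Group Γ] : Γ →* unitary (ℂ →L[ℂ] ℂ) := 1

end Representations

/-! ### Amenable and a-T-menable groups -/

section Groups

variable (Γ : Type*) [Group Γ]

/-- `h : Γ → ℂ` is positive definite. -/
def IsPosDef {Γ : Type*} [Group Γ] (h : Γ → ℂ) : Prop :=
  ∀ (n : ℕ) (s : Fin n → Γ),
    (Matrix.of fun i j : Fin n => h (s i * (s j)⁻¹)).PosSemidef

/-- `Γ` is amenable: there are finitely supported positive definite functions converging
pointwise to one. -/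
def IsAmenableGroup : Prop :=
  ∃ h : ℕ → Γ → ℂ, (∀ n, IsPosDef (h n)) ∧ (∀ n, (Function.support (h n)).Finite) ∧
    ∀ s, Tendsto (fun n => h n s) atTop (𝓝 1)

/-- `Γ` is a-T-menable (has the Haagerup property): there are positive definite functions
vanishing at infinity and converging pointwise to one. -/
def IsATMenableGroup : Prop :=
  ∃ h : ℕ → Γ → ℂ, (∀ n, IsPosDef (h n)) ∧ (∀ n, Tendsto (h n) cofinite (𝓝 0)) ∧
    ∀ s, Tendsto (fun n => h n s) atTop (𝓝 1)

end Groups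

/-! ### Amenable and a-T-menable actions -/

section Actions

/-- `h : X × Γ → ℂ` is positive definite, for an action of `Γ` on `X`. -/
def IsPosDefAction {Γ X : Type*} [Group Γ] [MulAction Γ X] (h : X × Γ → ℂ) : Prop :=
  ∀ (n : ℕ) (s : Fin n → Γ) (x : X),
    (Matrix.of fun i j : Fin n => h (s i • x, s i * (s j)⁻¹)).PosSemidef

variable (Γ X : Type*) [Group Γ] [TopologicalSpace Γ] [TopologicalSpace X] [MulAction Γ X]

/-- The action of the discrete group `Γ` on `X` is amenable: there are positive definite functions
in `C_c(X ⋊ Γ)` converging to one uniformly on compact sets. -/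
def IsAmenableAction : Prop :=
  ∃ h : ℕ → C_c(X × Γ, ℂ), (∀ n, IsPosDefAction (h n)) ∧
    ∀ K : Set (X × Γ), IsCompact K → TendstoUniformlyOn (fun n p => h n p) (fun _ => 1) atTop K

/-- The action of the discrete group `Γ` on `X` is a-T-menable: there are positive definite
functions in `C₀(X ⋊ Γ)` converging to one uniformly on compact sets. -/
def IsATMenableAction : Prop :=
  ∃ h : ℕ → C₀(X × Γ, ℂ), (∀ n, IsPosDefAction (h n)) ∧
    ∀ K : Set (X × Γ), IsCompact K → TendstoUniformlyOn (fun n p => h n p) (fun _ => 1) atTop K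

end Actions

/-! ### The unitary representation on `L²(X, μ)` of a quasi-invariant measure -/

section Koopman

variable {Γ X : Type*} [Group Γ] [MeasurableSpace X] [MulAction Γ X]

/-- The measure `μ` is quasi-invariant: elements of `Γ` map `μ`-null sets to `μ`-null sets. -/
def QuasiInvariant (Γ : Type*) {X : Type*} [Group Γ] [MeasurableSpace X] [MulAction Γ X]
    (μ : Measure X) : Prop :=
  ∀ (s : Γ) (A : Set X), μ A = 0 → μ ((fun x => s • x) '' A) = 0

/-- The Radon-Nikodym derivative `ρ_s` of the translate of `μ` by `s` with respect to `μ`. -/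
def rnCocycle (μ : Measure X) (s : Γ) : X → ℝ≥0∞ :=
  (μ.map (fun x => s • x)).rnDeriv μ

/-- The function `x ↦ f(s⁻¹ x) ρ_s(x)^{1/2}`. -/
def koopmanFun (μ : Measure X) (s : Γ) (f : X → ℂ) : X → ℂ :=
  fun x => f (s⁻¹ • x) * (Real.sqrt (rnCocycle μ s x).toReal : ℂ)

variable [MeasurableConstSMul Γ X] {μ : Measure X}

theorem QuasiInvariant.quasiMeasurePreserving (hμ : QuasiInvariant Γ μ) (s : Γ) :
    Measure.QuasiMeasurePreserving (fun x : X => s • x) μ μ := by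
  refine ⟨measurable_const_smul s, Measure.AbsolutelyContinuous.mk fun A hA h0 => ?_⟩
  rw [Measure.map_apply (measurable_const_smul s) hA]
  have := hμ s⁻¹ A h0
  rwa [show (fun x : X => s • x) ⁻¹' A = (fun x => s⁻¹ • x) '' A from
    (Set.preimage_smul s A)]

theorem measurable_rnCocycle (s : Γ) : Measurable (rnCocycle μ s) :=
  Measure.measurable_rnDeriv _ _

variable [∀ s : Γ, (μ.map (fun x => s • x)).HaveLebesgueDecomposition μ]

theorem withDensity_rnCocycle (hμ : QuasiInvariant Γ μ) (s : Γ) :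
    μ.withDensity (rnCocycle μ s) = μ.map (fun x => s • x) :=
  Measure.withDensity_rnDeriv_eq _ _ (hμ.quasiMeasurePreserving s).absolutelyContinuous

/-- `∫ φ dμ = ∫ (s.φ) ρ_s dμ`. -/
theorem lintegral_rnCocycle (hμ : QuasiInvariant Γ μ) (s : Γ) {φ : X → ℝ≥0∞}
    (hφ : AEMeasurable φ μ) :
    ∫⁻ x, rnCocycle μ s x * φ (s⁻¹ • x) ∂μ = ∫⁻ x, φ x ∂μ := by
  have h1 : AEMeasurable (fun x => φ (s⁻¹ • x)) μ :=
    hφ.comp_quasiMeasurePreserving (hμ.quasiMeasurePreserving s⁻¹)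
  have h2 : AEMeasurable (fun x => φ (s⁻¹ • x)) (μ.map (fun x => s • x)) :=
    h1.mono_ac (hμ.quasiMeasurePreserving s).absolutelyContinuous
  have h3 := lintegral_withDensity_eq_lintegral_mul₀
    (measurable_rnCocycle (μ := μ) s).aemeasurable h1
  rw [withDensity_rnCocycle hμ s, lintegral_map' h2 (measurable_const_smul s).aemeasurable] at h3
  simpa using h3.symm

theorem koopmanFun_congr (hμ : QuasiInvariant Γ μ) (s : Γ) {f g : X → ℂ} (h : f =ᵐ[μ] g) :
    koopmanFun μ s f =ᵐ[μ] koopmanFun μ s g := by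
  filter_upwards [(hμ.quasiMeasurePreserving s⁻¹).ae h] with x hx
  simp only [koopmanFun, hx]

theorem aestronglyMeasurable_koopmanFun (hμ : QuasiInvariant Γ μ) (s : Γ) {f : X → ℂ}
    (hf : AEStronglyMeasurable f μ) : AEStronglyMeasurable (koopmanFun μ s f) μ := by
  refine (hf.comp_quasiMeasurePreserving (hμ.quasiMeasurePreserving s⁻¹)).mul ?_
  exact (Complex.measurable_ofReal.comp
    (measurable_rnCocycle s).ennreal_toReal.sqrt).aestronglyMeasurable

theorem lintegral_enorm_sq_lt_top {f : X → ℂ} (hf : MemLp f 2 μ) :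
    ∫⁻ x, ‖f x‖ₑ ^ 2 ∂μ < ∞ := by
  have := hf.eLpNorm_lt_top
  rw [eLpNorm_lt_top_iff_lintegral_rpow_enorm_lt_top (by norm_num) (by norm_num)] at this
  simpa using this

theorem enorm_mul_sqrt_sq (z : ℂ) {r : ℝ≥0∞} (h : r * ‖z‖ₑ ^ 2 < ∞) :
    ‖z * (Real.sqrt r.toReal : ℂ)‖ₑ ^ 2 = r * ‖z‖ₑ ^ 2 := by
  rcases eq_or_ne z 0 with rfl | hz
  · simp
  have hr : r ≠ ∞ := by
    rintro rfl
    rw [ENNReal.top_mul (by simpa using hz)] at h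
    exact lt_irrefl _ h
  rw [enorm_mul, mul_pow, mul_comm]
  congr 1
  rw [← enorm_pow, ← Complex.ofReal_pow, Real.sq_sqrt ENNReal.toReal_nonneg,
    ← ofReal_norm, Complex.norm_real, Real.norm_of_nonneg ENNReal.toReal_nonneg,
    ENNReal.ofReal_toReal hr]

theorem ae_lt_top_koopman (hμ : QuasiInvariant Γ μ) (s : Γ) {f : X → ℂ} (hf : MemLp f 2 μ) :
    ∀ᵐ x ∂μ, rnCocycle μ s x * ‖f (s⁻¹ • x)‖ₑ ^ 2 < ∞ := by
  have hm : AEMeasurable (fun x => ‖f x‖ₑ ^ 2) μ := hf.1.enorm.pow_const 2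
  refine ae_lt_top' ((measurable_rnCocycle s).aemeasurable.mul
    (hm.comp_quasiMeasurePreserving (hμ.quasiMeasurePreserving s⁻¹))) ?_
  rw [lintegral_rnCocycle hμ s hm]
  exact (lintegral_enorm_sq_lt_top hf).ne

theorem eLpNorm_koopmanFun (hμ : QuasiInvariant Γ μ) (s : Γ) {f : X → ℂ} (hf : MemLp f 2 μ) :
    eLpNorm (koopmanFun μ s f) 2 μ = eLpNorm f 2 μ := by
  have hm : AEMeasurable (fun x => ‖f x‖ₑ ^ 2) μ := hf.1.enorm.pow_const 2
  have key : ∫⁻ x, ‖koopmanFun μ s f x‖ₑ ^ 2 ∂μ = ∫⁻ x, ‖f x‖ₑ ^ 2 ∂μ := by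
    rw [← lintegral_rnCocycle hμ s hm]
    refine lintegral_congr_ae ?_
    filter_upwards [ae_lt_top_koopman hμ s hf] with x hx
    exact enorm_mul_sqrt_sq _ hx
  rw [eLpNorm_eq_lintegral_rpow_enorm_toReal (by norm_num) (by norm_num),
    eLpNorm_eq_lintegral_rpow_enorm_toReal (by norm_num) (by norm_num)]
  simpa using congrArg (fun t : ℝ≥0∞ => t ^ (2⁻¹ : ℝ)) key

theorem memLp_koopmanFun (hμ : QuasiInvariant Γ μ) (s : Γ) {f : X → ℂ} (hf : MemLp f 2 μ) :
    MemLp (koopmanFun μ s f) 2 μ :=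
  ⟨aestronglyMeasurable_koopmanFun hμ s hf.1, by
    rw [eLpNorm_koopmanFun hμ s hf]; exact hf.2⟩

/-- Two densities of the same measure give the same weighted `L²` function. -/
theorem mul_sqrt_ae_eq {a b : X → ℝ≥0∞} (ha : Measurable a) (hb : Measurable b)
    (hab : μ.withDensity a = μ.withDensity b) {g : X → ℂ} (hg : AEStronglyMeasurable g μ)
    (hfin : ∫⁻ x, a x * ‖g x‖ₑ ^ 2 ∂μ ≠ ∞) :
    (fun x => g x * (Real.sqrt (a x).toReal : ℂ)) =ᵐ[μ]
      fun x => g x * (Real.sqrt (b x).toReal : ℂ) := by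
  have hm : AEMeasurable (fun x => ‖g x‖ₑ ^ 2) μ := hg.enorm.pow_const 2
  have h : (fun x => a x * ‖g x‖ₑ ^ 2) =ᵐ[μ] fun x => b x * ‖g x‖ₑ ^ 2 := by
    refine AEMeasurable.ae_eq_of_forall_setLIntegral_eq (ha.aemeasurable.mul hm)
      (hb.aemeasurable.mul hm) hfin ?_ fun A hA _ => ?_
    · have h1 := lintegral_withDensity_eq_lintegral_mul₀ ha.aemeasurable hm
      have h2 := lintegral_withDensity_eq_lintegral_mul₀ hb.aemeasurable hm
      rw [hab, h2] at h1
      simp only [Pi.mul_apply] at h1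
      rwa [h1]
    · have h1 := setLIntegral_withDensity_eq_lintegral_mul₀ ha.aemeasurable hm hA
      have h2 := setLIntegral_withDensity_eq_lintegral_mul₀ hb.aemeasurable hm hA
      rw [hab, h2] at h1
      simpa using h1.symm
  filter_upwards [h] with x hx
  rcases eq_or_ne (g x) 0 with h0 | h0
  · simp [h0]
  · have : a x = b x :=
      (ENNReal.mul_left_inj (by simpa using h0) (by finiteness)).1 hx
    rw [this]

theorem koopmanFun_one (hμ : QuasiInvariant Γ μ) {f : X → ℂ} (hf : MemLp f 2 μ) :
    koopmanFun μ (1 : Γ) f =ᵐ[μ] f := by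
  have h := mul_sqrt_ae_eq (μ := μ) (a := rnCocycle μ (1 : Γ)) (b := fun _ => 1)
    (measurable_rnCocycle 1) measurable_const (by
      rw [withDensity_rnCocycle hμ]; simp) (g := f) hf.1 (by
      have := lintegral_rnCocycle hμ (1 : Γ) (hf.1.enorm.pow_const 2)
      simp only [inv_one, one_smul] at this
      rw [this]
      exact (lintegral_enorm_sq_lt_top hf).ne)
  refine EventuallyEq.trans (Eventually.of_forall fun x => ?_) (h.trans ?_)
  · simp [koopmanFun]
  · exact Eventually.of_forall fun x => by simp

theorem withDensity_rnCocycle_mul (hμ : QuasiInvariant Γ μ) (s t : Γ) :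
    μ.withDensity (rnCocycle μ (s * t)) =
      μ.withDensity (fun x => rnCocycle μ s x * rnCocycle μ t (s⁻¹ • x)) := by
  have hms := measurable_rnCocycle (μ := μ) s
  have hmt := measurable_rnCocycle (μ := μ) t
  have hi : Measurable fun x : X => s⁻¹ • x := measurable_const_smul s⁻¹
  ext A hA
  rw [withDensity_rnCocycle hμ, Measure.map_apply (measurable_const_smul _) hA,
    withDensity_apply _ hA]
  have hB : MeasurableSet ((fun x : X => s • x) ⁻¹' A) := measurable_const_smul s hA
  have h1 : μ ((fun x : X => (s * t) • x) ⁻¹' A) =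
      ∫⁻ x in (fun x : X => s • x) ⁻¹' A, rnCocycle μ t x ∂μ := by
    rw [← withDensity_apply _ hB, withDensity_rnCocycle hμ,
      Measure.map_apply (measurable_const_smul _) hB]
    congr 1
    ext x
    simp [mul_smul]
  rw [h1, ← lintegral_indicator hB, ← lintegral_indicator hA,
    ← lintegral_rnCocycle hμ s (hmt.indicator hB).aemeasurable]
  refine lintegral_congr fun x => ?_
  by_cases hx : x ∈ A <;> simp [Set.indicator, hx]

theorem koopmanFun_mul (hμ : QuasiInvariant Γ μ) (s t : Γ) {f : X → ℂ} (hf : MemLp f 2 μ) :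
    koopmanFun μ (s * t) f =ᵐ[μ] koopmanFun μ s (koopmanFun μ t f) := by
  have h := mul_sqrt_ae_eq (μ := μ) (measurable_rnCocycle (s * t))
    ((measurable_rnCocycle s).mul ((measurable_rnCocycle t).comp (measurable_const_smul s⁻¹)))
    (withDensity_rnCocycle_mul hμ s t)
    (hf.1.comp_quasiMeasurePreserving (hμ.quasiMeasurePreserving (s * t)⁻¹)) (by
      have := lintegral_rnCocycle hμ (s * t) (hf.1.enorm.pow_const 2)
      simp only [Function.comp_apply]
      rw [this]
      exact (lintegral_enorm_sq_lt_top hf).ne)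
  refine h.trans (Eventually.of_forall fun x => ?_)
  simp only [koopmanFun, Function.comp_apply, mul_inv_rev, mul_smul, Pi.mul_apply,
    ENNReal.toReal_mul, Real.sqrt_mul ENNReal.toReal_nonneg, Complex.ofReal_mul]
  ring

variable (μ)

/-- The isometry `U_s f = (s.f) ρ_s^{1/2}` of `L²(X, μ)`. -/
def koopmanIsometry (hμ : QuasiInvariant Γ μ) (s : Γ) : Lp ℂ 2 μ →ₗᵢ[ℂ] Lp ℂ 2 μ where
  toFun f := (memLp_koopmanFun hμ s (Lp.memLp f)).toLp (koopmanFun μ s f)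
  map_add' f g := by
    rw [← MemLp.toLp_add, MemLp.toLp_eq_toLp_iff]
    refine (koopmanFun_congr hμ s (Lp.coeFn_add f g)).trans (Eventually.of_forall fun x => ?_)
    simp [koopmanFun, add_mul]
  map_smul' c f := by
    rw [RingHom.id_apply, ← MemLp.toLp_const_smul, MemLp.toLp_eq_toLp_iff]
    refine (koopmanFun_congr hμ s (Lp.coeFn_smul c f)).trans (Eventually.of_forall fun x => ?_)
    simp [koopmanFun, mul_assoc]
  norm_map' f := by
    change ‖(memLp_koopmanFun hμ s (Lp.memLp f)).toLp (koopmanFun μ s f)‖ = ‖f‖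
    rw [Lp.norm_toLp, eLpNorm_koopmanFun hμ s (Lp.memLp f), Lp.norm_def]

theorem coeFn_koopmanIsometry (hμ : QuasiInvariant Γ μ) (s : Γ) (f : Lp ℂ 2 μ) :
    koopmanIsometry μ hμ s f =ᵐ[μ] koopmanFun μ s f :=
  MemLp.coeFn_toLp (memLp_koopmanFun hμ s (Lp.memLp f))

theorem koopmanIsometry_one (hμ : QuasiInvariant Γ μ) (f : Lp ℂ 2 μ) :
    koopmanIsometry μ hμ (1 : Γ) f = f :=
  Lp.ext ((coeFn_koopmanIsometry μ hμ 1 f).trans (koopmanFun_one hμ (Lp.memLp f)))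

theorem koopmanIsometry_mul (hμ : QuasiInvariant Γ μ) (s t : Γ) (f : Lp ℂ 2 μ) :
    koopmanIsometry μ hμ (s * t) f = koopmanIsometry μ hμ s (koopmanIsometry μ hμ t f) := by
  refine Lp.ext ((coeFn_koopmanIsometry μ hμ _ f).trans ?_)
  refine (koopmanFun_mul hμ s t (Lp.memLp f)).trans ?_
  exact ((coeFn_koopmanIsometry μ hμ s _).trans
    (koopmanFun_congr hμ s (coeFn_koopmanIsometry μ hμ t f))).symm

/-- The representation `s ↦ U_s` by linear isometric equivalences of `L²(X, μ)`. -/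
def koopmanEquiv (hμ : QuasiInvariant Γ μ) : Γ →* (Lp ℂ 2 μ ≃ₗᵢ[ℂ] Lp ℂ 2 μ) where
  toFun s := LinearIsometryEquiv.mk
    (LinearEquiv.ofLinearMap (koopmanIsometry μ hμ s).toLinearMap
      (koopmanIsometry μ hμ s⁻¹).toLinearMap
      (by ext1 f; simp [← koopmanIsometry_mul, koopmanIsometry_one])
      (by ext1 f; simp [← koopmanIsometry_mul, koopmanIsometry_one]))
    (fun f => (koopmanIsometry μ hμ s).norm_map f)
  map_one' := by ext1 f; exact koopmanIsometry_one μ hμ f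
  map_mul' s t := by ext1 f; exact koopmanIsometry_mul μ hμ s t f

/-- The unitary representation of `Γ` on `L²(X, μ)` by `U_s f = (s.f) ρ_s^{1/2}`. -/
def koopmanRep (hμ : QuasiInvariant Γ μ) : Γ →* unitary (Lp ℂ 2 μ →L[ℂ] Lp ℂ 2 μ) :=
  Unitary.linearIsometryEquiv.symm.toMonoidHom.comp (koopmanEquiv μ hμ)

theorem coeFn_koopmanRep (hμ : QuasiInvariant Γ μ) (s : Γ) (f : Lp ℂ 2 μ) :
    (koopmanRep μ hμ s : Lp ℂ 2 μ →L[ℂ] Lp ℂ 2 μ) f =ᵐ[μ]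
      fun x => f (s⁻¹ • x) * (Real.sqrt (rnCocycle μ s x).toReal : ℂ) :=
  coeFn_koopmanIsometry μ hμ s f

end Koopman

end GroupDynamics

end

noncomputable section

namespace GroupDynamics

/-! ### Almost invariant vectors -/

/-! If `Γ` is amenable or a-T-menable, the functions `h n p.2` witness the same property for the
action; compactness of `X` makes the pullback along the projection to `Γ` preserve compact support
and vanishing at infinity.

The converse rests on an invariant state on `C(X)`. Weak containment of the trivial representation
yields unit vectors of `L²(X, μ)` that are almost invariant under any finite subset of `Γ`
(`exists_almost_invariant_vector`). Because the representation intertwines multiplication by `g`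
with multiplication by its translates, the vector states `g ↦ ⟨f, g f⟩` are then almost invariant,
and an ultrafilter limit gives an invariant state `φ` (`exists_invariant_state`). Integrating a
positive definite `h` on `X × Γ` against `φ` in the first variable gives a function on `Γ`, positive
definite by `isPosDef_average`; since `φ` is contractive and unital, supports, decay and convergence
to one also descend. -/

/-- By the parallelogram law `‖a - b‖² = 4 - ‖a + b‖²`, which is at most `ε² - ε⁴/16`. -/
theorem norm_sub_le_of_le_norm_add {H : Type*} [NormedAddCommGroup H] [InnerProductSpace ℂ H]
    {a b : H} (ha : ‖a‖ = 1) (hb : ‖b‖ = 1) {ε : ℝ} (hε : 0 ≤ ε) (hε' : ε ≤ 2)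
    (h : 2 - ε ^ 2 / 4 ≤ ‖a + b‖) : ‖a - b‖ ≤ ε := by
  have hp := parallelogram_law_with_norm ℂ a b
  rw [ha, hb] at hp
  have h0 : 0 ≤ 2 - ε ^ 2 / 4 := by nlinarith
  have h1 := mul_self_le_mul_self h0 h
  refine abs_le_of_sq_le_sq' (a := ‖a - b‖) ?_ hε |>.2
  nlinarith [sq_nonneg (ε ^ 2)]

theorem exists_almost_invariant_vector {Γ : Type*} [Group Γ] {H : Type*} [NormedAddCommGroup H]
    [InnerProductSpace ℂ H] [CompleteSpace H] {π : Γ →* unitary (H →L[ℂ] H)}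
    (hπ : WeaklyContains π (trivialRep Γ)) (S : Finset Γ) {ε : ℝ} (hε : 0 < ε) (hε' : ε ≤ 2) :
    ∃ f : H, ‖f‖ = 1 ∧ ∀ s ∈ S, ‖(π s : H →L[ℂ] H) f - f‖ ≤ ε := by
  classical
  have hnorm : ∀ (s : Γ) (f : H), ‖(π s : H →L[ℂ] H) f‖ = ‖f‖ := fun s f =>
    Unitary.norm_map (π s) f
  -- Including the identity puts `f` itself among the summands, so that each `π s f` can be compared
  -- with it.
  set S' := insert 1 S with hS'
  have hT := hπ (∑ s ∈ S', MonoidAlgebra.of ℂ Γ s)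
  have h1 : groupRingHom (trivialRep Γ) (∑ s ∈ S', MonoidAlgebra.of ℂ Γ s) =
      (S'.card : ℂ) • ContinuousLinearMap.id ℂ ℂ := by
    rw [map_sum]
    simp only [groupRingHom, MonoidAlgebra.lift_of]
    ext
    simp [trivialRep]
  have h2 : groupRingHom π (∑ s ∈ S', MonoidAlgebra.of ℂ Γ s) =
      ∑ s ∈ S', (π s : H →L[ℂ] H) := by
    rw [map_sum]
    simp only [groupRingHom, MonoidAlgebra.lift_of]
    simp
  rw [h1, h2, norm_smul, ContinuousLinearMap.norm_id, mul_one, Complex.norm_natCast] at hT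
  have hpos : 1 ≤ (S'.card : ℝ) := by
    exact_mod_cast Finset.card_pos.2 ⟨1, Finset.mem_insert_self _ _⟩
  -- The norm of the sum is at least `S'.card`, so any smaller threshold is exceeded on a unit
  -- vector; `ε ≤ 2` keeps this one nonnegative.
  have hlt : (S'.card - ε ^ 2 / 4 : ℝ).toNNReal < ‖∑ s ∈ S', (π s : H →L[ℂ] H)‖₊ := by
    have : 0 < ε ^ 2 := by positivity
    rw [Real.toNNReal_lt_iff_lt_coe (by nlinarith), coe_nnnorm]
    linarith
  obtain ⟨f, hf, hlt'⟩ :=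
    ContinuousLinearMap.exists_nnnorm_eq_one_lt_apply_of_lt_opNNNorm _ hlt
  have hf1 : ‖f‖ = 1 := by simpa using congrArg NNReal.toReal hf
  refine ⟨f, hf1, fun s hs => ?_⟩
  rcases eq_or_ne s 1 with rfl | hs1
  · simpa using hε.le
  refine norm_sub_le_of_le_norm_add ((hnorm s f).trans hf1) hf1 hε.le hε' ?_
  have hle : (S'.card - ε ^ 2 / 4 : ℝ) ≤ ‖∑ t ∈ S', (π t : H →L[ℂ] H) f‖ := by
    simpa using (Real.le_coe_toNNReal _).trans (NNReal.coe_le_coe.2 hlt'.le)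
  have hs' : s ∈ S' := Finset.mem_insert_of_mem hs
  have h1' : (1 : Γ) ∈ S'.erase s := Finset.mem_erase.2 ⟨hs1.symm, Finset.mem_insert_self _ _⟩
  rw [← Finset.add_sum_erase _ _ hs', ← Finset.add_sum_erase _ _ h1', ← add_assoc] at hle
  -- The other terms are unit vectors, so `π s f + f` must account for at least `2 - ε²/4` of the
  -- norm.
  have hrest : ‖∑ t ∈ (S'.erase s).erase 1, (π t : H →L[ℂ] H) f‖ ≤ S'.card - 2 := by
    refine (norm_sum_le _ _).trans ?_
    simp only [hnorm, hf1, Finset.sum_const, nsmul_eq_mul, mul_one]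
    have e1 := Finset.card_erase_add_one hs'
    have e2 := Finset.card_erase_add_one h1'
    have : (((S'.erase s).erase 1).card : ℝ) + 2 = S'.card := by
      exact_mod_cast (by omega : ((S'.erase s).erase 1).card + 2 = S'.card)
    linarith
  have := norm_add_le ((π s : H →L[ℂ] H) f + (π 1 : H →L[ℂ] H) f)
    (∑ t ∈ (S'.erase s).erase 1, (π t : H →L[ℂ] H) f)
  simp only [map_one, OneMemClass.coe_one, one_apply_eq_self] at this hle
  linarith

/-! ### Multiplication operators -/

section Multiplication

variable {X : Type*} [TopologicalSpace X] [CompactSpace X] [MeasurableSpace X] [BorelSpace X]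
  (μ : Measure X)

theorem memLp_continuousMap_mul (g : C(X, ℂ)) (f : Lp ℂ 2 μ) :
    MemLp (fun x => g x * f x) 2 μ :=
  MemLp.of_le_mul (c := ‖g‖) (Lp.memLp f)
    (g.continuous.measurable.aestronglyMeasurable.mul (Lp.aestronglyMeasurable f))
    (Eventually.of_forall fun x => by
      rw [norm_mul]
      exact mul_le_mul_of_nonneg_right (g.norm_coe_le_norm x) (norm_nonneg _))

/-- Multiplication of a square integrable function by a continuous function. -/
def mulLp (g : C(X, ℂ)) (f : Lp ℂ 2 μ) : Lp ℂ 2 μ :=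
  (memLp_continuousMap_mul μ g f).toLp _

theorem coeFn_mulLp (g : C(X, ℂ)) (f : Lp ℂ 2 μ) : mulLp μ g f =ᵐ[μ] fun x => g x * f x :=
  MemLp.coeFn_toLp _

theorem norm_mulLp_le (g : C(X, ℂ)) (f : Lp ℂ 2 μ) : ‖mulLp μ g f‖ ≤ ‖g‖ * ‖f‖ := by
  refine Lp.norm_le_mul_norm_of_ae_le_mul ?_
  filter_upwards [coeFn_mulLp μ g f] with x hx
  rw [hx, norm_mul]
  exact mul_le_mul_of_nonneg_right (g.norm_coe_le_norm x) (norm_nonneg _)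

theorem mulLp_sub (g : C(X, ℂ)) (f f' : Lp ℂ 2 μ) :
    mulLp μ g (f - f') = mulLp μ g f - mulLp μ g f' := by
  refine Lp.ext ?_
  filter_upwards [coeFn_mulLp μ g (f - f'), coeFn_mulLp μ g f, coeFn_mulLp μ g f',
    Lp.coeFn_sub f f', Lp.coeFn_sub (mulLp μ g f) (mulLp μ g f')] with x h1 h2 h3 h4 h5
  simp only [h1, h5, h4, Pi.sub_apply, h2, h3, mul_sub]

theorem mulLp_add_left (g g' : C(X, ℂ)) (f : Lp ℂ 2 μ) :
    mulLp μ (g + g') f = mulLp μ g f + mulLp μ g' f := by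
  refine Lp.ext ?_
  filter_upwards [coeFn_mulLp μ (g + g') f, coeFn_mulLp μ g f, coeFn_mulLp μ g' f,
    Lp.coeFn_add (mulLp μ g f) (mulLp μ g' f)] with x h1 h2 h3 h5
  simp only [h1, h5, Pi.add_apply, h2, h3, ContinuousMap.add_apply, add_mul]

theorem mulLp_smul_left (c : ℂ) (g : C(X, ℂ)) (f : Lp ℂ 2 μ) :
    mulLp μ (c • g) f = c • mulLp μ g f := by
  refine Lp.ext ?_
  filter_upwards [coeFn_mulLp μ (c • g) f, coeFn_mulLp μ g f,
    Lp.coeFn_smul c (mulLp μ g f)] with x h1 h2 h5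
  simp only [h1, h5, Pi.smul_apply, h2, ContinuousMap.smul_apply, smul_eq_mul, mul_assoc]

theorem mulLp_one (f : Lp ℂ 2 μ) : mulLp μ 1 f = f := by
  refine Lp.ext ?_
  filter_upwards [coeFn_mulLp μ 1 f] with x h1
  simp [h1]

theorem inner_mulLp_star (g : C(X, ℂ)) (f : Lp ℂ 2 μ) :
    inner ℂ f (mulLp μ (star g) f) = star (inner ℂ f (mulLp μ g f)) := by
  rw [← starRingEnd_apply (R := ℂ), inner_conj_symm, L2.inner_def, L2.inner_def]
  refine integral_congr_ae ?_
  filter_upwards [coeFn_mulLp μ g f, coeFn_mulLp μ (star g) f] with x h1 h2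
  simp only [h1, h2, RCLike.inner_apply, ContinuousMap.star_apply, map_mul, RCLike.star_def]
  ring

theorem inner_mulLp_nonneg {g : C(X, ℂ)} (hg : ∀ x, 0 ≤ g x) (f : Lp ℂ 2 μ) :
    0 ≤ inner ℂ f (mulLp μ g f) := by
  rw [L2.inner_def]
  refine integral_nonneg_of_ae ?_
  filter_upwards [coeFn_mulLp μ g f] with x h1
  simp only [h1, RCLike.inner_apply, Pi.zero_apply, mul_assoc]
  exact mul_nonneg (hg x) (RCLike.mul_conj (f x) ▸ by positivity)

end Multiplication

/-! ### Invariant states -/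

section States

variable {Γ X : Type*} [Group Γ] [TopologicalSpace X] [CompactSpace X] [MulAction Γ X]
  [ContinuousConstSMul Γ X]

/-- The translate `x ↦ g (s x)` of a continuous function. -/
def translate (s : Γ) (g : C(X, ℂ)) : C(X, ℂ) := ⟨fun x => g (s • x), by fun_prop⟩

variable [MeasurableSpace X] [BorelSpace X] (μ : Measure X)
  [∀ s : Γ, (μ.map (fun x => s • x)).HaveLebesgueDecomposition μ]

/-- Covariance: composing with `s⁻¹` undoes the translation of `g`, and the density factor commutes
with multiplication. -/
theorem koopmanRep_mulLp (hμ : QuasiInvariant Γ μ) (s : Γ) (g : C(X, ℂ)) (f : Lp ℂ 2 μ) :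
    (koopmanRep μ hμ s : Lp ℂ 2 μ →L[ℂ] Lp ℂ 2 μ) (mulLp μ (translate s g) f) =
      mulLp μ g ((koopmanRep μ hμ s : Lp ℂ 2 μ →L[ℂ] Lp ℂ 2 μ) f) := by
  refine Lp.ext ?_
  filter_upwards [coeFn_koopmanRep μ hμ s (mulLp μ (translate s g) f),
    coeFn_koopmanRep μ hμ s f,
    coeFn_mulLp μ g ((koopmanRep μ hμ s : Lp ℂ 2 μ →L[ℂ] Lp ℂ 2 μ) f),
    -- The almost everywhere identity is needed at `s⁻¹ • x`, which quasi-invariance permits.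
    (hμ.quasiMeasurePreserving s⁻¹).ae (coeFn_mulLp μ (translate s g) f)] with x h1 h2 h3 h4
  rw [h1, h3, h2, h4]
  simp [translate, mul_assoc]

/-- Covariance and unitarity turn the first term into the vector state of `U_s f`; moving one
argument of the inner product at a time costs `‖g‖ * ‖U_s f - f‖` twice. -/
theorem norm_inner_translate_sub_le (hμ : QuasiInvariant Γ μ) (s : Γ) (g : C(X, ℂ))
    (f : Lp ℂ 2 μ) (hf : ‖f‖ = 1) :
    ‖inner ℂ f (mulLp μ (translate s g) f) - inner ℂ f (mulLp μ g f)‖ ≤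
      2 * ‖g‖ * ‖(koopmanRep μ hμ s : Lp ℂ 2 μ →L[ℂ] Lp ℂ 2 μ) f - f‖ := by
  set u := (koopmanRep μ hμ s : Lp ℂ 2 μ →L[ℂ] Lp ℂ 2 μ) f with hu
  have hun : ‖u‖ = 1 := (Unitary.norm_map (koopmanRep μ hμ s) f).trans hf
  have h1 : inner ℂ f (mulLp μ (translate s g) f) = inner ℂ u (mulLp μ g u) := by
    rw [hu, ← koopmanRep_mulLp, Unitary.inner_map_map]
  have h2 : inner ℂ u (mulLp μ g u) - inner ℂ f (mulLp μ g f) =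
      inner ℂ (u - f) (mulLp μ g u) + inner ℂ f (mulLp μ g (u - f)) := by
    rw [mulLp_sub, inner_sub_left, inner_sub_right]
    ring
  rw [h1, h2]
  have h3 := norm_inner_le_norm (𝕜 := ℂ) (u - f) (mulLp μ g u)
  have h4 := norm_inner_le_norm (𝕜 := ℂ) f (mulLp μ g (u - f))
  have h5 := norm_mulLp_le μ g u
  have h6 := norm_mulLp_le μ g (u - f)
  rw [hun, mul_one] at h5
  rw [hf, one_mul] at h4
  have h7 := mul_le_mul_of_nonneg_left h5 (norm_nonneg (u - f))
  have := norm_add_le (inner ℂ (u - f) (mulLp μ g u)) (inner ℂ f (mulLp μ g (u - f)))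
  linarith

/-- If the Koopman representation weakly contains the trivial representation, then `C(X)` has an
invariant state. -/
theorem exists_invariant_state (hμ : QuasiInvariant Γ μ)
    (hweak : WeaklyContains (koopmanRep μ hμ) (trivialRep Γ)) :
    ∃ φ : C(X, ℂ) →ₗ[ℂ] ℂ, φ 1 = 1 ∧ (∀ g : C(X, ℂ), (∀ x, 0 ≤ g x) → 0 ≤ φ g) ∧
      (∀ g, φ (star g) = star (φ g)) ∧ (∀ g, ‖φ g‖ ≤ ‖g‖) ∧
      ∀ (s : Γ) (g : C(X, ℂ)), φ (translate s g) = φ g := by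
  classical
  have hex : ∀ i : Finset Γ × ℕ, ∃ f : Lp ℂ 2 μ, ‖f‖ = 1 ∧ ∀ s ∈ i.1,
      ‖(koopmanRep μ hμ s : Lp ℂ 2 μ →L[ℂ] Lp ℂ 2 μ) f - f‖ ≤ 1 / ((i.2 : ℝ) + 1) := fun i =>
    exists_almost_invariant_vector hweak i.1 (by positivity) (by
      rw [div_le_iff₀ (by positivity)]
      have : (0 : ℝ) ≤ i.2 := by positivity
      linarith)
  choose f hf hfS using hex
  let F : Finset Γ × ℕ → C(X, ℂ) → ℂ := fun i g => inner ℂ (f i) (mulLp μ g (f i))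
  have hF : ∀ i g, ‖F i g‖ ≤ ‖g‖ := fun i g => by
    have h1 := norm_inner_le_norm (𝕜 := ℂ) (f i) (mulLp μ g (f i))
    have h2 := norm_mulLp_le μ g (f i)
    rw [hf i, one_mul] at h1
    rw [hf i, mul_one] at h2
    exact h1.trans h2
  let ω : Ultrafilter (Finset Γ × ℕ) := Ultrafilter.of atTop
  have hω : (ω : Filter (Finset Γ × ℕ)) ≤ atTop := Ultrafilter.of_le _
  -- Each `F i g` stays in a compact disc, so it converges along the ultrafilter; the state
  -- identities pass to the limit.
  have hlim : ∀ g, ∃ z ∈ Metric.closedBall (0 : ℂ) ‖g‖, Tendsto (fun i => F i g) ω (𝓝 z) :=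
    fun g => (isCompact_closedBall (0 : ℂ) ‖g‖).ultrafilter_le_nhds (ω.map fun i => F i g)
      (le_principal_iff.2 (Ultrafilter.mem_map.2 (univ_mem' fun i => by simpa using hF i g)))
  choose φ hφb hφ using hlim
  refine ⟨{ toFun := φ, map_add' := fun g g' => ?_, map_smul' := fun c g => ?_ }, ?_, ?_, ?_, ?_,
    ?_⟩
  · refine tendsto_nhds_unique (hφ (g + g')) (((hφ g).add (hφ g')).congr fun i => ?_)
    simp only [F, mulLp_add_left, inner_add_right]
  · refine tendsto_nhds_unique (hφ (c • g)) (((hφ g).const_mul c).congr fun i => ?_)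
    simp only [F, mulLp_smul_left, inner_smul_right]
  · refine tendsto_nhds_unique (hφ 1) (tendsto_const_nhds.congr fun i => ?_)
    simp only [F, mulLp_one, inner_self_eq_norm_sq_to_K, hf i]
    simp
  · exact fun g hg => ge_of_tendsto' (hφ g) fun i => inner_mulLp_nonneg μ hg (f i)
  · intro g
    refine tendsto_nhds_unique (hφ (star g)) (((hφ g).star).congr fun i => ?_)
    exact (inner_mulLp_star μ g (f i)).symm
  · exact fun g => by simpa using hφb g
  · intro s g
    have h0 : Tendsto (fun i : Finset Γ × ℕ => 2 * ‖g‖ * (1 / ((i.2 : ℝ) + 1))) ω (𝓝 0) := by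
      have h := (tendsto_one_div_add_atTop_nhds_zero_nat (𝕜 := ℝ)).const_mul (2 * ‖g‖)
      rw [mul_zero] at h
      have h2 : Tendsto (Prod.snd : Finset Γ × ℕ → ℕ) atTop atTop := by
        rw [← prod_atTop_atTop_eq]; exact tendsto_snd
      exact (h.comp h2).mono_left hω
    have h1 : Tendsto (fun i => F i (translate s g) - F i g) ω (𝓝 0) := by
      refine squeeze_zero_norm' ?_ h0
      -- Eventually the finite set `i.1` contains `s`.
      filter_upwards [hω (mem_atTop (({s}, 0) : Finset Γ × ℕ))] with i hi
      refine (norm_inner_translate_sub_le μ hμ s g (f i) (hf i)).trans ?_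
      exact mul_le_mul_of_nonneg_left (hfS i s (hi.1 (Finset.mem_singleton_self s)))
        (by positivity)
    exact sub_eq_zero.1 (tendsto_nhds_unique ((hφ _).sub (hφ g)) h1)

end States

/-! ### Averaging over an invariant state -/

section Averaging

variable {Γ X : Type*} [Group Γ] [TopologicalSpace Γ] [DiscreteTopology Γ] [TopologicalSpace X]
  [CompactSpace X] [MulAction Γ X]

/-- The slice `x ↦ h (x, s)` of a continuous function on `X × Γ`. -/
def slice (h : C(X × Γ, ℂ)) (s : Γ) : C(X, ℂ) := ⟨fun x => h (x, s), by fun_prop⟩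

variable [ContinuousConstSMul Γ X]

/-- Invariance replaces the slice at `s i * (s j)⁻¹` by its translate under `s i`. The matrix
entries become `φ` of functions whose matrix is positive semidefinite at every point `x`, and
positivity of `φ` preserves this. -/
theorem isPosDef_average {φ : C(X, ℂ) →ₗ[ℂ] ℂ} (hpos : ∀ g : C(X, ℂ), (∀ x, 0 ≤ g x) → 0 ≤ φ g)
    (hstar : ∀ g, φ (star g) = star (φ g))
    (hinv : ∀ (s : Γ) (g : C(X, ℂ)), φ (translate s g) = φ g)
    {h : C(X × Γ, ℂ)} (hh : IsPosDefAction h) : IsPosDef fun s => φ (slice h s) := by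
  intro n s
  let G : Fin n → Fin n → C(X, ℂ) := fun i j => translate (s i) (slice h (s i * (s j)⁻¹))
  have hG : ∀ i j, φ (slice h (s i * (s j)⁻¹)) = φ (G i j) := fun i j => (hinv _ _).symm
  rw [Matrix.posSemidef_iff_dotProduct_mulVec]
  refine ⟨?_, fun c => ?_⟩
  · ext i j
    simp only [Matrix.conjTranspose_apply, Matrix.of_apply, hG]
    rw [← hstar]
    congr 1
    ext x
    exact congrFun (congrFun (hh n s x).1 i) j
  · have key : star c ⬝ᵥ (Matrix.of fun i j => φ (slice h (s i * (s j)⁻¹))).mulVec c =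
        φ (∑ i, star (c i) • ∑ j, c j • G i j) := by
      simp only [dotProduct, Matrix.mulVec, Matrix.of_apply, hG, map_sum, map_smul, Pi.star_apply,
        smul_eq_mul, mul_comm]
    rw [key]
    refine hpos _ fun x => ?_
    have := (Matrix.posSemidef_iff_dotProduct_mulVec.1 (hh n s x)).2 c
    simpa [dotProduct, Matrix.mulVec, G, translate, slice, mul_comm] using this

theorem tendsto_average {φ : C(X, ℂ) →ₗ[ℂ] ℂ} (hone : φ 1 = 1) (hbd : ∀ g, ‖φ g‖ ≤ ‖g‖)
    {h : ℕ → C(X × Γ, ℂ)}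
    (hh : ∀ K : Set (X × Γ), IsCompact K →
      TendstoUniformlyOn (fun n p => h n p) (fun _ => 1) atTop K) (s : Γ) :
    Tendsto (fun n => φ (slice (h n) s)) atTop (𝓝 1) := by
  rw [Metric.tendsto_nhds]
  intro ε hε
  -- On the compact set `X × {s}` uniform convergence is sup-norm convergence of the slices.
  have hK := Metric.tendstoUniformlyOn_iff.1
    (hh (Set.univ ×ˢ {s}) (isCompact_univ.prod isCompact_singleton)) (ε / 2) (by positivity)
  filter_upwards [hK] with n hn
  rw [dist_eq_norm, ← hone, ← map_sub]
  refine (hbd _).trans_lt (lt_of_le_of_lt ((ContinuousMap.norm_le _ (half_pos hε).le).2 fun x => ?_)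
    (half_lt_self hε))
  have := (hn (x, s) (by simp)).le
  rwa [dist_comm, dist_eq_norm] at this

end Averaging

/-! ### Amenable groups act amenably -/

section Constant

variable {Γ X : Type*} [Group Γ] [TopologicalSpace Γ] [DiscreteTopology Γ] [TopologicalSpace X]
  [MulAction Γ X]

theorem continuous_comp_snd (h : Γ → ℂ) : Continuous fun p : X × Γ => h p.2 :=
  continuous_of_discreteTopology.comp continuous_snd

theorem isPosDefAction_comp_snd {h : Γ → ℂ} (hh : IsPosDef h) :
    IsPosDefAction fun p : X × Γ => h p.2 := fun n s _ => hh n s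

theorem tendstoUniformlyOn_comp_snd {h : ℕ → Γ → ℂ} (hh : ∀ s, Tendsto (fun n => h n s) atTop (𝓝 1))
    {K : Set (X × Γ)} (hK : IsCompact K) :
    TendstoUniformlyOn (fun n (p : X × Γ) => h n p.2) (fun _ => 1) atTop K := by
  have hfin : (Prod.snd '' K).Finite := (hK.image continuous_snd).finite_of_discrete
  rw [Metric.tendstoUniformlyOn_iff]
  intro ε hε
  have : ∀ᶠ n in atTop, ∀ s ∈ Prod.snd '' K, dist 1 (h n s) < ε := by
    rw [hfin.eventually_all]
    intro s _
    filter_upwards [Metric.tendsto_nhds.1 (hh s) ε hε] with n hn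
    rwa [dist_comm]
  filter_upwards [this] with n hn p hp
  exact hn _ ⟨p, hp, rfl⟩

variable [CompactSpace X] [T2Space X]

theorem isAmenableAction_of_isAmenableGroup (h : IsAmenableGroup Γ) : IsAmenableAction Γ X := by
  obtain ⟨h, hpd, hsupp, hlim⟩ := h
  refine ⟨fun n => ⟨⟨fun p => h n p.2, continuous_comp_snd (h n)⟩,
    HasCompactSupport.intro (isCompact_univ.prod (hsupp n).isCompact) fun p hp => ?_⟩,
    fun n => isPosDefAction_comp_snd (hpd n), fun K hK => tendstoUniformlyOn_comp_snd hlim hK⟩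
  by_contra h0
  exact hp ⟨trivial, h0⟩

theorem isATMenableAction_of_isATMenableGroup (h : IsATMenableGroup Γ) :
    IsATMenableAction Γ X := by
  obtain ⟨h, hpd, hzero, hlim⟩ := h
  refine ⟨fun n => ⟨⟨fun p => h n p.2, continuous_comp_snd (h n)⟩, ?_⟩,
    fun n => isPosDefAction_comp_snd (hpd n), fun K hK => tendstoUniformlyOn_comp_snd hlim hK⟩
  have h1 := hzero n
  rw [← cocompact_eq_cofinite] at h1
  refine h1.comp ?_
  -- As `X` is compact, only the coordinate in `Γ` can go to infinity.
  have : (cocompact (X × Γ)) ≤ comap Prod.snd (cocompact Γ) := by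
    rw [← coprod_cocompact, Filter.cocompact_eq_bot, Filter.bot_coprod]
  exact tendsto_iff_comap.2 this

end Constant

/-! ### Groups acting amenably -/

section Descent

variable {Γ X : Type*} [Group Γ] [TopologicalSpace Γ] [DiscreteTopology Γ] [TopologicalSpace X]
  [CompactSpace X] [MulAction Γ X] [ContinuousConstSMul Γ X] [MeasurableSpace X] [BorelSpace X]
  (μ : Measure X) [∀ s : Γ, (μ.map (fun x => s • x)).HaveLebesgueDecomposition μ]

theorem isAmenableGroup_of_isAmenableAction (hμ : QuasiInvariant Γ μ)
    (hweak : WeaklyContains (koopmanRep μ hμ) (trivialRep Γ)) (h : IsAmenableAction Γ X) :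
    IsAmenableGroup Γ := by
  obtain ⟨φ, hone, hpos, hstar, hbd, hinv⟩ := exists_invariant_state μ hμ hweak
  obtain ⟨h, hpd, hlim⟩ := h
  refine ⟨fun n s => φ (slice (h n).toContinuousMap s),
    fun n => isPosDef_average hpos hstar hinv (hpd n), fun n => ?_,
    fun s => tendsto_average hone hbd hlim s⟩
  -- The projection of the compact support to the discrete group is finite, and slices outside it
  -- vanish.
  refine ((h n).hasCompactSupport.isCompact.image continuous_snd).finite_of_discrete.subset
    fun s hs => ?_
  by_contra hns
  refine hs ?_
  have h0 : slice (h n).toContinuousMap s = 0 := by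
    ext x
    by_contra hx
    exact hns ⟨(x, s), subset_tsupport _ hx, rfl⟩
  simp only [h0, map_zero]

theorem isATMenableGroup_of_isATMenableAction (hμ : QuasiInvariant Γ μ)
    (hweak : WeaklyContains (koopmanRep μ hμ) (trivialRep Γ)) (h : IsATMenableAction Γ X) :
    IsATMenableGroup Γ := by
  obtain ⟨φ, hone, hpos, hstar, hbd, hinv⟩ := exists_invariant_state μ hμ hweak
  obtain ⟨h, hpd, hlim⟩ := h
  refine ⟨fun n s => φ (slice (h n).toContinuousMap s),
    fun n => isPosDef_average hpos hstar hinv (hpd n), fun n => ?_,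
    fun s => tendsto_average hone hbd hlim s⟩
  rw [Metric.tendsto_nhds]
  intro ε hε
  have h1 := Metric.tendsto_nhds.1 ((h n).zero_at_infty') (ε / 2) (half_pos hε)
  obtain ⟨K, hK, hKs⟩ := mem_cocompact.1 h1
  -- For `s` outside the finite projection of `K` the whole slice is below `ε / 2`; the halving
  -- absorbs the nonstrict sup-norm bound.
  filter_upwards [(hK.image continuous_snd).finite_of_discrete.compl_mem_cofinite] with s hs
  rw [dist_zero_right]
  refine (hbd _).trans_lt (lt_of_le_of_lt ((ContinuousMap.norm_le _ (half_pos hε).le).2 fun x => ?_)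
    (half_lt_self hε))
  have h2 : dist (h n (x, s)) 0 < ε / 2 := hKs fun hx => hs ⟨(x, s), hx, rfl⟩
  rw [dist_zero_right] at h2
  exact h2.le

end Descent

end GroupDynamics

end

theorem mainTheorem7 {Γ X : Type*} [Group Γ] [Countable Γ] [TopologicalSpace Γ]
    [DiscreteTopology Γ] [TopologicalSpace X] [CompactSpace X] [T2Space X] [MulAction Γ X]
    [ContinuousConstSMul Γ X] [MeasurableSpace X] [BorelSpace X] (μ : Measure X)
    (hμ : GroupDynamics.QuasiInvariant Γ μ)
    [∀ s : Γ, (μ.map (fun x => s • x)).HaveLebesgueDecomposition μ]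
    (hweak : GroupDynamics.WeaklyContains (GroupDynamics.koopmanRep μ hμ)
      (GroupDynamics.trivialRep Γ)) :
    (GroupDynamics.IsAmenableAction Γ X ↔ GroupDynamics.IsAmenableGroup Γ) ∧
    (GroupDynamics.IsATMenableAction Γ X ↔ GroupDynamics.IsATMenableGroup Γ) ∧
    (¬ GroupDynamics.IsATMenableGroup Γ → ¬ GroupDynamics.IsATMenableAction Γ X) := by
  have h2 : GroupDynamics.IsATMenableAction Γ X ↔ GroupDynamics.IsATMenableGroup Γ :=
    ⟨GroupDynamics.isATMenableGroup_of_isATMenableAction μ hμ hweak,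
      GroupDynamics.isATMenableAction_of_isATMenableGroup⟩
  exact ⟨⟨GroupDynamics.isAmenableGroup_of_isAmenableAction μ hμ hweak,
    GroupDynamics.isAmenableAction_of_isAmenableGroup⟩, h2, mt h2.1⟩
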